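/- Let $\mathcal A$ be a C*-algebra (not necessarily unital), and let $S(\mathcal A)$ be its state space, i.e. the set of positive linear functionals $\psi:\mathcal A\to\mathbb C$ with $\|\psi\|=1$. For $\psi_1,\psi_2\in S(\mathcal A)$ let $$P(\psi_1|\psi_2)=\sup |\langle x,y\rangle|^2,$$ where the supremum runs over all Hilbert spaces $\mathcal H$, all $*$-representations $\pi:\mathcal A\to B(\mathcal H)$ and all unit vectors $x,y\in\mathcal H$ such that $\psi_1(a)=\langle\pi(a)x,x\rangle$ and $\psi_2(a)=\langle\pi(a)y,y\rangle$ for every $a\in\mathcal A$, and let $F(\psi_1|\psi_2)=\sqrt{P(\psi_1|\psi_2)}$ be the fidelity. Then this supremum is over a non-empty bounded set, $0\le F(\psi_1|\psi_2)\le 1$, and the map $$d(\psi_1,\psi_2)=\arccos F(\psi_1|\psi_2)$$ (the Bures angle) is a metric on $S(\mathcal A)$. -/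

import Mathlib

open scoped ComplexOrder InnerProductSpace

universe u

noncomputable section

/-- A state on a (not necessarily unital) C⋆-algebra `A`: a positive linear functional of norm one.
If `A` is unital, the norm condition is equivalent to `ψ 1 = 1`. -/
@[ext]
structure CStarState (A : Type u) [NonUnitalCStarAlgebra A] where
  /-- The underlying bounded linear functional. -/
  functional : A →L[ℂ] ℂ
  nonneg : ∀ a : A, 0 ≤ functional (star a * a)
  norm_eq_one : ‖functional‖ = 1

namespace CStarState

variable {A : Type u} [NonUnitalCStarAlgebra A]

/-- The vector `x`, together with the representation `π` of `A` on the Hilbert space `H`, implements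
the state `ψ`: `x` is a unit vector and `ψ(a) = ⟨π(a) x, x⟩` for all `a`. (The inner product of
Mathlib is linear in its second argument.) -/
def IsImplementedBy (ψ : CStarState A) {H : Type u} [NormedAddCommGroup H] [InnerProductSpace ℂ H]
    [CompleteSpace H] (π : A →⋆ₙₐ[ℂ] (H →L[ℂ] H)) (x : H) : Prop :=
  ‖x‖ = 1 ∧ ∀ a : A, ψ.functional a = ⟪x, π a x⟫_ℂ

/-- The set of all numbers `|⟨x, y⟩|²`, where `x` and `y` are unit vectors implementing `ψ₁` and `ψ₂`
in a common representation of `A` on a Hilbert space. (Hilbert spaces in the universe of `A` are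
enough: only the closed invariant subspace generated by `x` and `y` matters, and its cardinality
is bounded in terms of that of `A`.) -/
def overlaps (ψ₁ ψ₂ : CStarState A) : Set ℝ :=
  {r : ℝ | ∃ (H : Type u) (_ : NormedAddCommGroup H) (_ : InnerProductSpace ℂ H)
    (_ : CompleteSpace H) (π : A →⋆ₙₐ[ℂ] (H →L[ℂ] H)) (x y : H),
    ψ₁.IsImplementedBy π x ∧ ψ₂.IsImplementedBy π y ∧ r = ‖⟪x, y⟫_ℂ‖ ^ 2}

/-- Uhlmann's transition probability `P(ψ₁|ψ₂)`. -/
def transitionProbability (ψ₁ ψ₂ : CStarState A) : ℝ :=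
  sSup (overlaps ψ₁ ψ₂)

/-- The fidelity `F(ψ₁|ψ₂)`. -/
def fidelity (ψ₁ ψ₂ : CStarState A) : ℝ :=
  Real.sqrt (transitionProbability ψ₁ ψ₂)

/-- The Bures angle `arccos F(ψ₁|ψ₂)`. -/
def buresAngle (ψ₁ ψ₂ : CStarState A) : ℝ :=
  Real.arccos (fidelity ψ₁ ψ₂)

end CStarState

end

/-! In a single Hilbert space the angle between complex lines satisfies the triangle inequality. The
difficulty is that overlaps for `(ψ₁, ψ₂)` and `(ψ₂, ψ₃)` come from different representations, with
different vectors `y`, `y'` implementing `ψ₂`. Uniqueness of the GNS representation gives an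
intertwining partial isometry taking `y'` to `y`. It is used to map the second representation
isometrically into the direct sum so that `y'` lands on `y` (`exists_mem_overlaps_arccos_le`).
Continuity of `arccos √r` carries the inequality over to the suprema.

Definiteness holds because an overlap near one forces the states to be close
(`norm_functional_sub_le_of_mem_overlaps`). -/

namespace CStarState

open ContinuousLinearMap Filter Topology

variable {A : Type u} [NonUnitalCStarAlgebra A]

/-! ### GNS construction without a unit -/

/-- A state, as a positive linear map with respect to a star order on the algebra. -/
noncomputable def toPositiveLinearMap [PartialOrder A] [StarOrderedRing A] (ψ : CStarState A) :
    A →ₚ[ℂ] ℂ :=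
  PositiveLinearMap.mk₀ ψ.functional.toLinearMap fun a ha ↦ by
    obtain ⟨b, rfl⟩ := CStarAlgebra.nonneg_iff_eq_star_mul_self.mp ha
    exact ψ.nonneg b

@[simp]
theorem toPositiveLinearMap_apply [PartialOrder A] [StarOrderedRing A] (ψ : CStarState A) (a : A) :
    ψ.toPositiveLinearMap a = ψ.functional a := rfl

/-- A state is bounded by the norm of its GNS space. -/
theorem norm_functional_le_norm_toPreGNS [PartialOrder A] [StarOrderedRing A] (ψ : CStarState A)
    (a : A) : ‖ψ.functional a‖ ≤ ‖ψ.toPositiveLinearMap.toPreGNS a‖ := by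
  have hl := CStarAlgebra.increasingApproximateUnit A
  -- For an approximate unit `e`, `ψ (e * a)` tends to `ψ a` and is the GNS inner product of `e` and
  -- `a`. Cauchy–Schwarz applies, and `e` has GNS norm at most one.
  refine le_of_tendsto
    ((ψ.functional.continuous.tendsto a).norm.comp (hl.tendsto_mul_right a)) ?_
  filter_upwards [hl.eventually_star_eq, hl.eventually_norm] with e he hn
  rw [Function.comp_apply]
  have h := norm_inner_le_norm (𝕜 := ℂ) (ψ.toPositiveLinearMap.toPreGNS e)
    (ψ.toPositiveLinearMap.toPreGNS a)
  rw [PositiveLinearMap.preGNS_inner_def] at h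
  simp only [PositiveLinearMap.ofPreGNS_toPreGNS, he, toPositiveLinearMap_apply] at h
  refine h.trans (mul_le_of_le_one_left (norm_nonneg _) ?_)
  rw [PositiveLinearMap.preGNS_norm_def, Real.sqrt_le_one]
  refine (Complex.re_le_norm _).trans ((ψ.functional.le_opNorm _).trans ?_)
  rw [ψ.norm_eq_one, one_mul]
  refine (norm_mul_le _ _).trans ?_
  rw [norm_star]
  exact mul_le_one₀ hn (norm_nonneg _) hn

/-- A vector implementing the functional of a state is a unit vector if its norm is at most one. -/
theorem isImplementedBy_of_norm_le_one (ψ : CStarState A) {H : Type u} [NormedAddCommGroup H]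
    [InnerProductSpace ℂ H] [CompleteSpace H] {π : A →⋆ₙₐ[ℂ] (H →L[ℂ] H)} {x : H} (hx : ‖x‖ ≤ 1)
    (h : ∀ a, ψ.functional a = ⟪x, π a x⟫_ℂ) : ψ.IsImplementedBy π x := by
  refine ⟨le_antisymm hx ?_, h⟩
  suffices (1 : ℝ) ≤ ‖x‖ * ‖x‖ by nlinarith [norm_nonneg x]
  rw [← ψ.norm_eq_one]
  refine ψ.functional.opNorm_le_bound (by positivity) fun a ↦ ?_
  rw [h a]
  calc ‖⟪x, π a x⟫_ℂ‖ ≤ ‖x‖ * (‖π a‖ * ‖x‖) :=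
        (norm_inner_le_norm _ _).trans (by gcongr; exact (π a).le_opNorm x)
    _ ≤ ‖x‖ * (‖a‖ * ‖x‖) := by gcongr; exact NonUnitalStarAlgHom.norm_apply_le π a
    _ = ‖x‖ * ‖x‖ * ‖a‖ := by ring

/-- The Gelfand–Naimark–Segal theorem for states of a not necessarily unital C⋆-algebra. -/
theorem exists_cyclic_isImplementedBy (ψ : CStarState A) :
    ∃ (H : Type u) (_ : NormedAddCommGroup H) (_ : InnerProductSpace ℂ H) (_ : CompleteSpace H)
      (π : A →⋆ₙₐ[ℂ] (H →L[ℂ] H)) (x : H),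
      ψ.IsImplementedBy π x ∧ DenseRange fun a ↦ π a x := by
  let _ := CStarAlgebra.spectralOrder A
  let _ := CStarAlgebra.spectralOrderedRing A
  let f := ψ.toPositiveLinearMap
  let ι : A →ₗ[ℂ] f.GNS := (UniformSpace.Completion.toComplL (𝕜 := ℂ) (E := f.PreGNS)).toLinearMap ∘ₗ
    f.toPreGNS.toLinearMap
  have hι : DenseRange ι :=
    (UniformSpace.Completion.denseRange_coe (α := f.PreGNS)).comp f.toPreGNS.surjective.denseRange
      (UniformSpace.Completion.continuous_coe _)
  have hιι (a b : A) : ⟪ι a, ι b⟫_ℂ = ψ.functional (star a * b) :=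
    UniformSpace.Completion.inner_coe _ _
  have hπι (a b : A) : f.gnsNonUnitalStarAlgHom a (ι b) = ι (a * b) :=
    f.gnsNonUnitalStarAlgHom_apply_coe
  have hbound (a : A) : ‖ψ.functional a‖ ≤ 1 * ‖ι a‖ := by
    rw [one_mul]
    exact (ψ.norm_functional_le_norm_toPreGNS a).trans_eq
      (UniformSpace.Completion.norm_coe (E := f.PreGNS) _).symm
  -- With no class of `1` available, the cyclic vector is the Riesz representative of the state
  -- extended to the GNS space.
  let φ : f.GNS →L[ℂ] ℂ := ψ.functional.toLinearMap.extendOfNorm ι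
  have hφ (a : A) : φ (ι a) = ψ.functional a :=
    LinearMap.extendOfNorm_eq hι ⟨1, hbound⟩ a
  have hφn : ‖φ‖ ≤ 1 := LinearMap.opNorm_extendOfNorm_le hι zero_le_one hbound
  let ξ : f.GNS := (InnerProductSpace.toDual ℂ f.GNS).symm φ
  have hξ (v : f.GNS) : ⟪ξ, v⟫_ℂ = φ v := InnerProductSpace.toDual_symm_apply
  have hπξ (a : A) : f.gnsNonUnitalStarAlgHom a ξ = ι a := by
    refine hι.eq_of_inner_left (𝕜 := ℂ) fun b ↦ ?_
    rw [hιι, ← ContinuousLinearMap.adjoint_inner_right, ← ContinuousLinearMap.star_eq_adjoint,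
      ← map_star, hπι, hξ, hφ]
  refine ⟨f.GNS, inferInstance, inferInstance, inferInstance, f.gnsNonUnitalStarAlgHom, ξ,
    isImplementedBy_of_norm_le_one ψ ?_ fun a ↦ ?_, ?_⟩
  · exact ((InnerProductSpace.toDual ℂ f.GNS).symm.norm_map φ).trans_le hφn
  · rw [hπξ, hξ, hφ]
  · simpa only [hπξ] using hι

/-! ### Intertwiners and direct sums -/

section Representations

variable {H K : Type u} [NormedAddCommGroup H] [InnerProductSpace ℂ H] [CompleteSpace H]
  [NormedAddCommGroup K] [InnerProductSpace ℂ K] [CompleteSpace K]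
  {π : A →⋆ₙₐ[ℂ] (H →L[ℂ] H)} {ρ : A →⋆ₙₐ[ℂ] (K →L[ℂ] K)}

theorem inner_rep_star (π : A →⋆ₙₐ[ℂ] (H →L[ℂ] H)) (a : A) (v w : H) :
    ⟪π (star a) v, w⟫_ℂ = ⟪v, π a w⟫_ℂ := by
  rw [map_star, star_eq_adjoint, adjoint_inner_left]

theorem rep_mul_apply (π : A →⋆ₙₐ[ℂ] (H →L[ℂ] H)) (a b : A) (v : H) :
    π (a * b) v = π a (π b v) := by
  rw [map_mul]
  rfl

/-- The adjoint of an intertwiner is an intertwiner. -/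
theorem adjoint_intertwines {T : H →L[ℂ] K} (hT : ∀ a v, T (π a v) = ρ a (T v)) (a : A) (w : K) :
    adjoint T (ρ a w) = π a (adjoint T w) := by
  refine ext_inner_right ℂ fun v ↦ ?_
  have h := inner_rep_star π (star a) (adjoint T w) v
  have h' := inner_rep_star ρ (star a) w (T v)
  rw [star_star] at h h'
  rw [adjoint_inner_left, h, h', adjoint_inner_left, hT]

theorem IsImplementedBy.norm_rep_apply_sq {ψ : CStarState A} {x : H} (h : ψ.IsImplementedBy π x)
    (a : A) : ((‖π a x‖ ^ 2 : ℝ) : ℂ) = ψ.functional (star a * a) := by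
  rw [h.2, rep_mul_apply, ← star_star a, ← inner_rep_star, star_star, star_star,
    inner_self_eq_norm_sq_to_K]
  simp

/-- A cyclic representation implementing a state embeds into every other one. -/
theorem IsImplementedBy.exists_isometric_intertwiner {ψ : CStarState A} {x : H} {y : K}
    (hx : ψ.IsImplementedBy π x) (hd : DenseRange fun a ↦ π a x) (hy : ψ.IsImplementedBy ρ y) :
    ∃ T : H →ₗᵢ[ℂ] K, T x = y ∧ ∀ a v, T (π a v) = ρ a (T v) := by
  let e : A →ₗ[ℂ] H := ⟨⟨fun a ↦ π a x, by simp⟩, by simp⟩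
  let f : A →ₗ[ℂ] K := ⟨⟨fun a ↦ ρ a y, by simp⟩, by simp⟩
  have hnorm (a : A) : ‖f a‖ = ‖e a‖ := by
    rw [← sq_eq_sq₀ (norm_nonneg _) (norm_nonneg _), ← Complex.ofReal_inj]
    exact (hy.norm_rep_apply_sq a).trans (hx.norm_rep_apply_sq a).symm
  have he : DenseRange e := hd
  let T₀ : H →L[ℂ] K := f.extendOfNorm e
  have hT₀ (a : A) : T₀ (π a x) = ρ a y :=
    LinearMap.extendOfNorm_eq he ⟨1, fun a ↦ by rw [one_mul, hnorm]⟩ a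
  have hTn (v : H) : ‖T₀ v‖ = ‖v‖ := by
    refine hd.induction_on v (isClosed_eq (by fun_prop) (by fun_prop)) fun a ↦ ?_
    rw [hT₀]
    exact hnorm a
  let T : H →ₗᵢ[ℂ] K := ⟨T₀.toLinearMap, hTn⟩
  have hTe (a : A) : T (π a x) = ρ a y := hT₀ a
  have hTc : Continuous T := T.continuous
  have hTi (a : A) (v : H) : T (π a v) = ρ a (T v) := by
    refine hd.induction_on v (isClosed_eq (by fun_prop) (by fun_prop)) fun b ↦ ?_
    rw [hTe, ← rep_mul_apply, ← rep_mul_apply, hTe]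
  -- `T x = y` is not immediate, since `x` need not be of the form `π a x`. But every `ρ a` kills `T
  -- x - y`, so this vector is orthogonal to the range of `T`. Hence `⟪T x, y⟫ = 1`, the equality
  -- case of Cauchy–Schwarz for unit vectors.
  have hort (v : H) : ⟪T x - y, T v⟫_ℂ = 0 := by
    refine hd.induction_on v (isClosed_eq (by fun_prop) (by fun_prop)) fun a ↦ ?_
    rw [hTe, ← inner_rep_star, map_sub, ← hTi, hTe, sub_self, inner_zero_left]
  have hxT : ⟪T x, y⟫_ℂ = 1 := by
    have h := hort x
    rw [inner_sub_left, inner_self_eq_norm_sq_to_K, T.norm_map, hx.1, sub_eq_zero] at h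
    rw [← inner_conj_symm, ← h]
    simp
  refine ⟨T, ?_, hTi⟩
  exact (inner_eq_one_iff_of_norm_eq_one (𝕜 := ℂ) (by rw [T.norm_map, hx.1]) hy.1).mp hxT

/-- Two representations implementing the same state are related by a partial isometry between the
cyclic subspaces of the implementing vectors. -/
theorem IsImplementedBy.exists_partialIsometry {ψ : CStarState A} {x : H} {y : K}
    (hx : ψ.IsImplementedBy π x) (hy : ψ.IsImplementedBy ρ y) :
    ∃ U : H →L[ℂ] K, U x = y ∧ adjoint U y = x ∧ (∀ a v, U (π a v) = ρ a (U v)) ∧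
      ∀ v, U (adjoint U (U v)) = U v := by
  obtain ⟨G, _, _, _, σ, ξ, hξ, hd⟩ := ψ.exists_cyclic_isImplementedBy
  obtain ⟨S, hSx, hS⟩ := hξ.exists_isometric_intertwiner hd hx
  obtain ⟨T, hTy, hT⟩ := hξ.exists_isometric_intertwiner hd hy
  let S' := S.toContinuousLinearMap
  let T' := T.toContinuousLinearMap
  have hSS (v : G) : adjoint S' (S' v) = v := congr($(S.adjoint_comp_self) v)
  have hTT (v : G) : adjoint T' (T' v) = v := congr($(T.adjoint_comp_self) v)
  have hS'x : S' ξ = x := hSx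
  have hT'y : T' ξ = y := hTy
  -- Project onto the cyclic subspace of `x`, identify it with the GNS space, then embed that space
  -- in `K`.
  refine ⟨T' ∘L adjoint S', ?_, ?_, fun a v ↦ ?_, fun v ↦ ?_⟩
  · rw [comp_apply, ← hS'x, hSS, hT'y]
  · rw [adjoint_comp, adjoint_adjoint, comp_apply, ← hT'y, hTT, hS'x]
  · rw [comp_apply, adjoint_intertwines (T := S') hS]
    exact hT a _
  · simp only [adjoint_comp, adjoint_adjoint, comp_apply, hSS, hTT]

/-- The orthogonal direct sum of two representations. -/
theorem exists_directSum (π : A →⋆ₙₐ[ℂ] (H →L[ℂ] H)) (ρ : A →⋆ₙₐ[ℂ] (K →L[ℂ] K)) :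
    ∃ (G : Type u) (_ : NormedAddCommGroup G) (_ : InnerProductSpace ℂ G) (_ : CompleteSpace G)
      (σ : A →⋆ₙₐ[ℂ] (G →L[ℂ] G)) (I : H →ₗᵢ[ℂ] G) (J : K →ₗᵢ[ℂ] G),
      (∀ v w, ⟪I v, J w⟫_ℂ = 0) ∧ (∀ a v, σ a (I v) = I (π a v)) ∧
        ∀ a w, σ a (J w) = J (ρ a w) := by
  let I : H →ₗᵢ[ℂ] WithLp 2 (H × K) :=
    ⟨(WithLp.linearEquiv 2 ℂ (H × K)).symm.toLinearMap ∘ₗ LinearMap.inl ℂ H K, fun v ↦ by simp⟩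
  let J : K →ₗᵢ[ℂ] WithLp 2 (H × K) :=
    ⟨(WithLp.linearEquiv 2 ℂ (H × K)).symm.toLinearMap ∘ₗ LinearMap.inr ℂ H K, fun v ↦ by simp⟩
  let I' := I.toContinuousLinearMap
  let J' := J.toContinuousLinearMap
  have hIJ (v : H) (w : K) : ⟪I v, J w⟫_ℂ = 0 := by simp [I, J, WithLp.prod_inner_apply]
  have hII (v : H) : adjoint I' (I' v) = v := congr($(I.adjoint_comp_self) v)
  have hJJ (v : K) : adjoint J' (J' v) = v := congr($(J.adjoint_comp_self) v)
  have hI'J (w : K) : adjoint I' (J' w) = 0 :=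
    ext_inner_left ℂ fun v ↦ by rw [adjoint_inner_right, inner_zero_right]; exact hIJ v w
  have hJ'I (v : H) : adjoint J' (I' v) = 0 :=
    ext_inner_right ℂ fun w ↦ by rw [adjoint_inner_left, inner_zero_left]; exact hIJ v w
  let σ : A →⋆ₙₐ[ℂ] (WithLp 2 (H × K) →L[ℂ] WithLp 2 (H × K)) :=
    { toFun a := I' ∘L π a ∘L adjoint I' + J' ∘L ρ a ∘L adjoint J'
      map_smul' c a := by ext1 v; simp
      map_zero' := by simp
      map_add' a b := by ext1 v; simp; abel
      map_mul' a b := by ext1 v; simp [hII, hJJ, hI'J, hJ'I]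
      map_star' a := by simp [star_eq_adjoint, map_star, adjoint_comp, comp_assoc] }
  refine ⟨WithLp 2 (H × K), inferInstance, inferInstance, inferInstance, σ, I, J, hIJ,
    fun a v ↦ ?_, fun a w ↦ ?_⟩
  · change I' (π a (adjoint I' (I' v))) + J' (ρ a (adjoint J' (I' v))) = I' (π a v)
    simp [hII, hJ'I]
  · change I' (π a (adjoint I' (J' w))) + J' (ρ a (adjoint J' (J' w))) = J' (ρ a w)
    simp [hJJ, hI'J]

end Representations

/-! ### Angle between complex lines -/

section Angle

variable {E : Type*} [NormedAddCommGroup E] [InnerProductSpace ℂ E]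

/-- Multiplying a vector by a phase makes its inner product with another one nonnegative. -/
theorem exists_phase_inner_eq_norm (x y : E) :
    ∃ c : ℂ, ‖c‖ = 1 ∧ ⟪c • x, y⟫_ℂ = (‖⟪x, y⟫_ℂ‖ : ℂ) := by
  obtain ⟨c, hc, h⟩ := RCLike.exists_norm_eq_mul_self ⟪x, y⟫_ℂ
  exact ⟨star c, by simpa using hc, by
    rw [inner_smul_left, starRingEnd_apply, star_star]; exact h.symm⟩

/-- The triangle inequality for the angle between complex lines. -/
theorem arccos_norm_inner_le_add {x y z : E} (hx : ‖x‖ = 1) (hy : ‖y‖ = 1) (hz : ‖z‖ = 1) :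
    Real.arccos ‖⟪x, z⟫_ℂ‖ ≤ Real.arccos ‖⟪x, y⟫_ℂ‖ + Real.arccos ‖⟪y, z⟫_ℂ‖ := by
  let _ : InnerProductSpace ℝ E := InnerProductSpace.complexToReal
  obtain ⟨c, hc, hxy⟩ := exists_phase_inner_eq_norm x y
  obtain ⟨d, hd, hzy⟩ := exists_phase_inner_eq_norm z y
  have angle_eq {v w : E} (hv : ‖v‖ = 1) (hw : ‖w‖ = 1) :
      InnerProductGeometry.angle v w = Real.arccos (⟪v, w⟫_ℂ).re := by
    rw [InnerProductGeometry.angle, hv, hw, mul_one, div_one]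
    rfl
  have hcx : ‖c • x‖ = 1 := by rw [norm_smul, hc, hx, one_mul]
  have hdz : ‖d • z‖ = 1 := by rw [norm_smul, hd, hz, one_mul]
  -- The phases make both inner products with `y` nonnegative, so the real angles at `y` are the
  -- complex ones. The remaining real angle can only exceed the complex one.
  have h := InnerProductGeometry.angle_le_angle_add_angle (c • x) y (d • z)
  rw [InnerProductGeometry.angle_comm y, angle_eq hcx hdz, angle_eq hcx hy, angle_eq hdz hy, hxy,
    hzy, Complex.ofReal_re, Complex.ofReal_re, norm_inner_symm z y] at h
  refine (Real.antitone_arccos ((Complex.re_le_norm _).trans_eq ?_)).trans h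
  rw [inner_smul_left, inner_smul_right, norm_mul, norm_mul, hd, RCLike.norm_conj, hc, one_mul,
    one_mul]

end Angle

/-! ### Overlaps and the metric axioms -/

variable {ψ₁ ψ₂ ψ₃ : CStarState A} {r s : ℝ}

theorem IsImplementedBy.norm_inner_sq_mem_overlaps {H : Type u} [NormedAddCommGroup H]
    [InnerProductSpace ℂ H] [CompleteSpace H] {π : A →⋆ₙₐ[ℂ] (H →L[ℂ] H)} {x y : H}
    (hx : ψ₁.IsImplementedBy π x) (hy : ψ₂.IsImplementedBy π y) :
    ‖⟪x, y⟫_ℂ‖ ^ 2 ∈ overlaps ψ₁ ψ₂ :=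
  ⟨H, inferInstance, inferInstance, inferInstance, π, x, y, hx, hy, rfl⟩

theorem overlaps_nonempty (ψ₁ ψ₂ : CStarState A) : (overlaps ψ₁ ψ₂).Nonempty := by
  obtain ⟨H, _, _, _, π, x, hx, -⟩ := ψ₁.exists_cyclic_isImplementedBy
  obtain ⟨K, _, _, _, ρ, y, hy, -⟩ := ψ₂.exists_cyclic_isImplementedBy
  obtain ⟨G, _, _, _, σ, I, J, -, hI, hJ⟩ := exists_directSum π ρ
  have hIx : ψ₁.IsImplementedBy σ (I x) :=
    ⟨by rw [I.norm_map, hx.1], fun a ↦ by rw [hI, I.inner_map_map, hx.2]⟩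
  have hJy : ψ₂.IsImplementedBy σ (J y) :=
    ⟨by rw [J.norm_map, hy.1], fun a ↦ by rw [hJ, J.inner_map_map, hy.2]⟩
  exact ⟨_, hIx.norm_inner_sq_mem_overlaps hJy⟩

theorem mem_Icc_of_mem_overlaps (h : r ∈ overlaps ψ₁ ψ₂) : r ∈ Set.Icc (0 : ℝ) 1 := by
  obtain ⟨H, _, _, _, π, x, y, hx, hy, rfl⟩ := h
  refine ⟨by positivity, pow_le_one₀ (norm_nonneg _) ?_⟩
  simpa [hx.1, hy.1] using norm_inner_le_norm (𝕜 := ℂ) x y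

theorem bddAbove_overlaps (ψ₁ ψ₂ : CStarState A) : BddAbove (overlaps ψ₁ ψ₂) :=
  ⟨1, fun _ h ↦ (mem_Icc_of_mem_overlaps h).2⟩

theorem isLUB_transitionProbability (ψ₁ ψ₂ : CStarState A) :
    IsLUB (overlaps ψ₁ ψ₂) (transitionProbability ψ₁ ψ₂) :=
  isLUB_csSup (overlaps_nonempty ψ₁ ψ₂) (bddAbove_overlaps ψ₁ ψ₂)

theorem transitionProbability_mem_closure (ψ₁ ψ₂ : CStarState A) :
    transitionProbability ψ₁ ψ₂ ∈ closure (overlaps ψ₁ ψ₂) :=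
  csSup_mem_closure (overlaps_nonempty ψ₁ ψ₂) (bddAbove_overlaps ψ₁ ψ₂)

theorem transitionProbability_le_one (ψ₁ ψ₂ : CStarState A) : transitionProbability ψ₁ ψ₂ ≤ 1 :=
  (isLUB_transitionProbability ψ₁ ψ₂).2 fun _ h ↦ (mem_Icc_of_mem_overlaps h).2

theorem fidelity_mem_Icc (ψ₁ ψ₂ : CStarState A) : fidelity ψ₁ ψ₂ ∈ Set.Icc (0 : ℝ) 1 :=
  ⟨Real.sqrt_nonneg _, Real.sqrt_le_one.mpr (transitionProbability_le_one ψ₁ ψ₂)⟩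

theorem overlaps_comm (ψ₁ ψ₂ : CStarState A) : overlaps ψ₁ ψ₂ = overlaps ψ₂ ψ₁ := by
  have h (φ χ : CStarState A) : overlaps φ χ ⊆ overlaps χ φ := by
    rintro _ ⟨H, _, _, _, π, x, y, hx, hy, rfl⟩
    rw [norm_inner_symm]
    exact hy.norm_inner_sq_mem_overlaps hx
  exact (h _ _).antisymm (h _ _)

theorem buresAngle_comm (ψ₁ ψ₂ : CStarState A) : buresAngle ψ₁ ψ₂ = buresAngle ψ₂ ψ₁ := by
  rw [buresAngle, fidelity, transitionProbability, overlaps_comm]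
  rfl

theorem buresAngle_le_of_mem_overlaps (h : r ∈ overlaps ψ₁ ψ₂) :
    buresAngle ψ₁ ψ₂ ≤ Real.arccos √r :=
  Real.antitone_arccos (Real.sqrt_le_sqrt ((isLUB_transitionProbability ψ₁ ψ₂).1 h))

/-- Allows bounds on individual overlaps to pass to the supremum without knowing that it is
attained: it lies in the closure, and the bound is a closed condition. -/
theorem le_buresAngle_add {c k : ℝ} (h : ∀ r ∈ overlaps ψ₁ ψ₂, c ≤ Real.arccos √r + k) :
    c ≤ buresAngle ψ₁ ψ₂ + k := by
  have hc : IsClosed {r : ℝ | c ≤ Real.arccos √r + k} :=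
    isClosed_le continuous_const ((Real.continuous_arccos.comp Real.continuous_sqrt).add_const k)
  exact closure_minimal h hc (transitionProbability_mem_closure ψ₁ ψ₂)

theorem buresAngle_self (ψ : CStarState A) : buresAngle ψ ψ = 0 := by
  refine le_antisymm ?_ (Real.arccos_nonneg _)
  obtain ⟨H, _, _, _, π, x, hx, -⟩ := ψ.exists_cyclic_isImplementedBy
  refine (buresAngle_le_of_mem_overlaps (hx.norm_inner_sq_mem_overlaps hx)).trans_eq ?_
  simp [inner_self_eq_norm_sq_to_K, hx.1]

/-- Two implementing vectors of a state can be amalgamated: overlaps with a common middle state are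
realized in one representation. -/
theorem exists_mem_overlaps_arccos_le (hr : r ∈ overlaps ψ₁ ψ₂) (hs : s ∈ overlaps ψ₂ ψ₃) :
    ∃ t ∈ overlaps ψ₁ ψ₃, Real.arccos √t ≤ Real.arccos √r + Real.arccos √s := by
  obtain ⟨H, _, _, _, π, x, y, hx, hy, rfl⟩ := hr
  obtain ⟨K, _, _, _, ρ, y', z, hy', hz, rfl⟩ := hs
  obtain ⟨G, _, _, _, σ, I, J, hIJ, hI, hJ⟩ := exists_directSum π ρ
  obtain ⟨U, hUy, hUy', hU, hUU⟩ := hy'.exists_partialIsometry hy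
  have hIx : ψ₁.IsImplementedBy σ (I x) :=
    ⟨by rw [I.norm_map, hx.1], fun a ↦ by rw [hI, I.inner_map_map, hx.2]⟩
  -- The map `u ↦ I (U u) + J (u - U* U u)` moves the initial space of `U` into `H` and leaves its
  -- complement in `K`. It is an isometric intertwiner sending `y'` to `I y`.
  have hinner (u v : K) : ⟪I (U u) + J (u - adjoint U (U u)), I (U v) + J (v - adjoint U (U v))⟫_ℂ
      = ⟪u, v⟫_ℂ := by
    have hJI (v : H) (w : K) : ⟪J w, I v⟫_ℂ = 0 := by
      rw [← inner_conj_symm, hIJ, map_zero]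
    rw [inner_add_left, inner_add_right, inner_add_right, hIJ, hJI, I.inner_map_map,
      J.inner_map_map, add_zero, zero_add, inner_sub_right, inner_sub_left, inner_sub_left,
      adjoint_inner_right, adjoint_inner_left, adjoint_inner_left, hUU]
    ring
  have hz' : ψ₃.IsImplementedBy σ (I (U z) + J (z - adjoint U (U z))) := by
    constructor
    · rw [@norm_eq_sqrt_re_inner ℂ, hinner, ← @norm_eq_sqrt_re_inner ℂ, hz.1]
    · intro a
      rw [hz.2, ← hinner, hU, adjoint_intertwines (T := U) hU, map_add (σ a), hI, hJ, map_sub (ρ a)]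
  refine ⟨_, hIx.norm_inner_sq_mem_overlaps hz', ?_⟩
  have hyz : ⟪I y, I (U z) + J (z - adjoint U (U z))⟫_ℂ = ⟪y', z⟫_ℂ := by
    rw [inner_add_right, hIJ, add_zero, I.inner_map_map, ← hUy', adjoint_inner_left]
  have h := arccos_norm_inner_le_add (y := I y) hIx.1 (by rw [I.norm_map, hy.1]) hz'.1
  rw [hyz, I.inner_map_map] at h
  simpa only [Real.sqrt_sq (norm_nonneg _)] using h

theorem buresAngle_triangle (ψ₁ ψ₂ ψ₃ : CStarState A) :
    buresAngle ψ₁ ψ₃ ≤ buresAngle ψ₁ ψ₂ + buresAngle ψ₂ ψ₃ := by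
  refine le_buresAngle_add fun r hr ↦ ?_
  rw [add_comm]
  refine le_buresAngle_add fun s hs ↦ ?_
  obtain ⟨t, ht, h⟩ := exists_mem_overlaps_arccos_le hr hs
  rw [add_comm]
  exact (buresAngle_le_of_mem_overlaps ht).trans h

/-- A phase change of `x` leaves the state unchanged and makes the overlap equal to `√r`, so that
`‖c • x - y‖² = 2 - 2√r`. -/
theorem norm_functional_sub_le_of_mem_overlaps (hr : r ∈ overlaps ψ₁ ψ₂) (a : A) :
    ‖ψ₁.functional a - ψ₂.functional a‖ ≤ 2 * ‖a‖ * √(2 - 2 * √r) := by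
  obtain ⟨H, _, _, _, π, x, y, hx, hy, rfl⟩ := hr
  obtain ⟨c, hc, hxy⟩ := exists_phase_inner_eq_norm x y
  have hcx : ‖c • x‖ = 1 := by rw [norm_smul, hc, hx.1, one_mul]
  have hψ₁ : ψ₁.functional a = ⟪c • x, π a (c • x)⟫_ℂ := by
    rw [hx.2, map_smul, inner_smul_left, inner_smul_right, ← mul_assoc, RCLike.conj_mul, hc]
    simp
  have hsub : ‖c • x - y‖ = √(2 - 2 * √(‖⟪x, y⟫_ℂ‖ ^ 2)) := by
    rw [Real.sqrt_sq (norm_nonneg _), eq_comm, Real.sqrt_eq_iff_eq_sq _ (norm_nonneg _),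
      @norm_sub_sq ℂ, hcx, hy.1, hxy]
    · simp; ring
    · have := norm_inner_le_norm (𝕜 := ℂ) x y
      rw [hx.1, hy.1] at this
      linarith
  have hop (v : H) : ‖π a v‖ ≤ ‖a‖ * ‖v‖ :=
    (π a).le_of_opNorm_le (NonUnitalStarAlgHom.norm_apply_le π a) v
  rw [← hsub, hψ₁, hy.2]
  calc ‖⟪c • x, π a (c • x)⟫_ℂ - ⟪y, π a y⟫_ℂ‖
      = ‖⟪c • x - y, π a (c • x)⟫_ℂ + ⟪y, π a (c • x - y)⟫_ℂ‖ := by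
        rw [inner_sub_left, map_sub, inner_sub_right, sub_add_sub_cancel]
    _ ≤ ‖c • x - y‖ * (‖a‖ * ‖c • x‖) + ‖y‖ * (‖a‖ * ‖c • x - y‖) :=
        (norm_add_le _ _).trans (add_le_add
          ((norm_inner_le_norm _ _).trans (by gcongr; exact hop _))
          ((norm_inner_le_norm _ _).trans (by gcongr; exact hop _)))
    _ = 2 * ‖a‖ * ‖c • x - y‖ := by rw [hcx, hy.1]; ring

theorem eq_of_buresAngle_eq_zero (h : buresAngle ψ₁ ψ₂ = 0) : ψ₁ = ψ₂ := by
  have hP : transitionProbability ψ₁ ψ₂ = 1 :=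
    (transitionProbability_le_one ψ₁ ψ₂).antisymm (Real.one_le_sqrt.mp (Real.arccos_eq_zero.mp h))
  ext a
  have hc : IsClosed
      {r : ℝ | ‖ψ₁.functional a - ψ₂.functional a‖ ≤ 2 * ‖a‖ * √(2 - 2 * √r)} :=
    isClosed_le continuous_const (by fun_prop)
  -- The bound extends to the supremum by closedness; its right side vanishes when the transition
  -- probability is one.
  have : ‖ψ₁.functional a - ψ₂.functional a‖ ≤
      2 * ‖a‖ * √(2 - 2 * √(transitionProbability ψ₁ ψ₂)) :=
    closure_minimal (fun r hr ↦ norm_functional_sub_le_of_mem_overlaps hr a) hc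
      (transitionProbability_mem_closure ψ₁ ψ₂)
  rw [hP] at this
  simpa [sub_eq_zero] using this

end CStarState

theorem mainTheorem7 {A : Type u} [NonUnitalCStarAlgebra A] :
    (∀ ψ₁ ψ₂ : CStarState A,
      IsLUB (CStarState.overlaps ψ₁ ψ₂) (CStarState.transitionProbability ψ₁ ψ₂) ∧
      CStarState.fidelity ψ₁ ψ₂ ∈ Set.Icc (0 : ℝ) 1) ∧
    ∃ m : MetricSpace (CStarState A), ∀ ψ₁ ψ₂ : CStarState A,
      m.dist ψ₁ ψ₂ = CStarState.buresAngle ψ₁ ψ₂ :=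
  ⟨fun ψ₁ ψ₂ ↦ ⟨CStarState.isLUB_transitionProbability ψ₁ ψ₂, CStarState.fidelity_mem_Icc ψ₁ ψ₂⟩,
    { dist := CStarState.buresAngle
      dist_self := CStarState.buresAngle_self
      dist_comm := CStarState.buresAngle_comm
      dist_triangle := CStarState.buresAngle_triangle
      eq_of_dist_eq_zero := CStarState.eq_of_buresAngle_eq_zero }, fun _ _ ↦ rfl⟩
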